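/- **Theorem 2.2 (Nonlinear sliding dynamics from smoothing).** Let $f:\mathbb R^{d}\times\mathbb R\times\mathbb R\to\mathbb R^{d}$ and $g:\mathbb R^{d}\times\mathbb R\times\mathbb R\to\mathbb R$ be smooth ($C^\infty$) functions of $(x,y,u)$, let $|\cdot|$ be the Euclidean norm, and let $M$ be such that for all $x$ with $|x|\le M$ $$g(x,0;+1)<0<g(x,0;-1)\quad\text{and}\quad \frac{\partial g}{\partial u}(x,0;u)<0\ \text{ for all } u\in[-1,1].$$ For $|x|\le M$ let $U(x)$ be the unique $u\in[-1,1]$ with $g(x,0;u)=0$ (the equivalent control). Let $\phi:\mathbb R\to\mathbb R$ be smooth with $\phi(w)=\operatorname{sign}(w)$ for $|w|>1$, $\phi(w)\in[-1,1]$ for $|w|\le 1$, and $\phi'(w)>0$ for $|w|<1$. Fix $T>0$ and let $x_U$ be a solution on $[0,T]$ of Utkin's equivalent control system $\dot x=f(x,0;U(x))$ with $|x_U(t)|<M$ for $0\le t\le T$. Then there exist constants $\alpha_0>0$ and $L>0$ such that for every $0<\alpha\le\alpha_0$ and every $y_0\in[-\alpha,\alpha]$ the smoothed system $$\dot x=f\big(x,y;\phi(y/\alpha)\big),\qquad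 \dot y=g\big(x,y;\phi(y/\alpha)\big),\qquad (x(0),y(0))=(x_U(0),y_0),$$ has a solution on $[0,T]$, and every solution $(x,y)$ on $[0,T]$ of it satisfies $$|x(t)-x_U(t)|\le L\alpha\qquad\text{for all } 0\le t\le T.$$ -/

import Mathlib

open scoped ContDiff

noncomputable section

/-- The state space of the variable `x`, i.e. `ℝ^d` with its Euclidean norm (`d = n - 1`). -/
abbrev XSpace (d : ℕ) := EuclideanSpace ℝ (Fin d)

/-- Joint smoothness of a function of `(x, y, u)`. -/
def SmoothXYU {d : ℕ} {F : Type*} [NormedAddCommGroup F] [NormedSpace ℝ F]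
    (h : XSpace d → ℝ → ℝ → F) : Prop :=
  ContDiff ℝ ∞ (fun p : XSpace d × ℝ × ℝ => h p.1 p.2.1 p.2.2)

/-- For `|x| ≤ M` the flow points towards `y = 0` from both sides, and `g(x, 0; u)` is strictly
decreasing in the switching quantity `u ∈ [-1, 1]`, in the sense `∂g/∂u < 0`. -/
structure SlidingCondition {d : ℕ} (g : XSpace d → ℝ → ℝ → ℝ) (M : ℝ) : Prop where
  plus_neg : ∀ x, ‖x‖ ≤ M → g x 0 1 < 0
  minus_pos : ∀ x, ‖x‖ ≤ M → 0 < g x 0 (-1)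
  deriv_neg : ∀ x, ‖x‖ ≤ M → ∀ u ∈ Set.Icc (-1 : ℝ) 1, deriv (fun v => g x 0 v) u < 0

open Classical in
/-- Utkin's equivalent control `U(x)`: the value `u ∈ [-1, 1]` with `g(x, 0; u) = 0`
(and `0` if there is none, which does not occur in the region of the sliding condition). -/
def equivalentControl {d : ℕ} (g : XSpace d → ℝ → ℝ → ℝ) (x : XSpace d) : ℝ :=
  if h : ∃ u ∈ Set.Icc (-1 : ℝ) 1, g x 0 u = 0 then h.choose else 0

/-- Under the sliding condition the equivalent control is well defined: `U(x)` is the one and only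
element of `[-1, 1]` with `g(x, 0; U(x)) = 0`. -/
theorem equivalentControl_unique {d : ℕ} {g : XSpace d → ℝ → ℝ → ℝ} {M : ℝ}
    (hg : SmoothXYU g) (hs : SlidingCondition g M) {x : XSpace d} (hx : ‖x‖ ≤ M) (u : ℝ) :
    (u ∈ Set.Icc (-1 : ℝ) 1 ∧ g x 0 u = 0) ↔ u = equivalentControl g x := by
  have hc : Continuous (fun v => g x 0 v) :=
    hg.continuous.comp (by fun_prop : Continuous fun v : ℝ => ((x, 0, v) : XSpace d × ℝ × ℝ))
  have hex : ∃ u ∈ Set.Icc (-1 : ℝ) 1, g x 0 u = 0 :=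
    intermediate_value_Icc' (by norm_num) hc.continuousOn
      ⟨(hs.plus_neg x hx).le, (hs.minus_pos x hx).le⟩
  have hanti : StrictAntiOn (fun v => g x 0 v) (Set.Icc (-1 : ℝ) 1) :=
    strictAntiOn_of_deriv_neg (convex_Icc _ _) hc.continuousOn
      fun v hv => hs.deriv_neg x hx v (interior_subset hv)
  have hU : equivalentControl g x = hex.choose := dif_pos hex
  have hspec := hex.choose_spec
  rw [hU]
  constructor
  · rintro ⟨hu, h0⟩
    exact hanti.injOn hu hspec.1 (h0.trans hspec.2.symm)
  · rintro rfl
    exact hspec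

/-- The sliding vector field `f_U(x) = f(x, 0; U(x))` of the equivalent control method. -/
def utkinField {d : ℕ} (f : XSpace d → ℝ → ℝ → XSpace d) (g : XSpace d → ℝ → ℝ → ℝ)
    (x : XSpace d) : XSpace d :=
  f x 0 (equivalentControl g x)

/-- `xU` solves `x' = f_U(x)` on `[0, T]` (one-sided derivatives at the end points). -/
def IsUtkinSolution {d : ℕ} (f : XSpace d → ℝ → ℝ → XSpace d) (g : XSpace d → ℝ → ℝ → ℝ)
    (T : ℝ) (xU : ℝ → XSpace d) : Prop :=
  ∀ t ∈ Set.Icc 0 T, HasDerivWithinAt xU (utkinField f g (xU t)) (Set.Icc 0 T) t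

/-- A smooth sigmoid: `φ(w) = sign w` for `|w| > 1`, `φ(w) ∈ [-1, 1]` for `|w| ≤ 1`, and
`φ'(w) > 0` for `|w| < 1`. -/
structure IsSmoothSwitch (φ : ℝ → ℝ) : Prop where
  smooth : ContDiff ℝ ∞ φ
  eq_sign : ∀ w, 1 < |w| → φ w = Real.sign w
  mem_Icc : ∀ w, |w| ≤ 1 → φ w ∈ Set.Icc (-1 : ℝ) 1
  deriv_pos : ∀ w, |w| < 1 → 0 < deriv φ w

/-- `(x, y)` solves `x' = f(x, y; u)`, `y' = g(x, y; u)` with `u = φ(y / α)` on `[0, T]`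
(one-sided derivatives at the end points). -/
def IsSmoothedSolution {d : ℕ} (f : XSpace d → ℝ → ℝ → XSpace d) (g : XSpace d → ℝ → ℝ → ℝ)
    (φ : ℝ → ℝ) (α T : ℝ) (x : ℝ → XSpace d) (y : ℝ → ℝ) : Prop :=
  ∀ t ∈ Set.Icc 0 T,
    HasDerivWithinAt x (f (x t) (y t) (φ (y t / α))) (Set.Icc 0 T) t ∧
    HasDerivWithinAt y (g (x t) (y t) (φ (y t / α))) (Set.Icc 0 T) t

end

/-! As functions of `u`, both `f(x,0;u) - f_U(x)` and `g(x,0;u)` vanish at `u = U(x)`, and `∂g/∂u`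
is bounded away from zero on a compact set. Hence the first is `g(x,0;u) H(x,u)` with `H` bounded
and Lipschitz (`exists_sliding_multiplier`). In the layer `|y| ≤ α` a smoothed trajectory therefore
satisfies `x' = f_U(x) + y' H(x, φ(y/α)) + O(α)`. The middle term need not be small, but it is the
total derivative of `k = ∫_0^y H(x, φ(s/α)) ds`, up to the effect of moving `x` inside an integral
of length at most `α`. Since `k = O(α)`, Grönwall applied to `x - x_U - k` gives the rate `α`
(`norm_sub_le_of_oscillating_perturbation`). The layer is invariant because `φ(±1) = ±1` and `g`
points inward at `y = ±α` (`mem_Icc_of_inward`). Existence comes from a truncated bounded field: its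
solution stays so close to `x_U` that the truncation is inactive, and uniqueness carries the
estimate to every solution. -/

open Set Filter Topology

/-! ### Compactness bounds and divided differences in `u`. -/

section SmoothFunctions

variable {d : ℕ} {F : Type*} [NormedAddCommGroup F] [NormedSpace ℝ F] {h : XSpace d → ℝ → ℝ → F}

theorem SmoothXYU.exists_bound_lipschitz (hh : SmoothXYU h) (M : ℝ) :
    ∃ C : ℝ, 0 ≤ C ∧
      (∀ x y u, ‖x‖ ≤ M → y ∈ Icc (-1 : ℝ) 1 → u ∈ Icc (-1 : ℝ) 1 → ‖h x y u‖ ≤ C) ∧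
      ∀ x y u x' y' u', ‖x‖ ≤ M → y ∈ Icc (-1 : ℝ) 1 → u ∈ Icc (-1 : ℝ) 1 →
        ‖x'‖ ≤ M → y' ∈ Icc (-1 : ℝ) 1 → u' ∈ Icc (-1 : ℝ) 1 →
        ‖h x y u - h x' y' u'‖ ≤ C * (‖x - x'‖ + |y - y'| + |u - u'|) := by
  set s : Set (XSpace d × ℝ × ℝ) :=
    Metric.closedBall 0 M ×ˢ (Icc (-1 : ℝ) 1 ×ˢ Icc (-1 : ℝ) 1)
  have hs : IsCompact s := (isCompact_closedBall _ _).prod (isCompact_Icc.prod isCompact_Icc)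
  have hs' : Convex ℝ s := (convex_closedBall _ _).prod ((convex_Icc _ _).prod (convex_Icc _ _))
  have hmem : ∀ x y u, ‖x‖ ≤ M → y ∈ Icc (-1 : ℝ) 1 → u ∈ Icc (-1 : ℝ) 1 → (x, y, u) ∈ s :=
    fun x y u hx hy hu => ⟨by simpa using hx, hy, hu⟩
  obtain ⟨K, hK⟩ := hh.contDiffOn.exists_lipschitzOnWith (by simp) hs' hs
  obtain ⟨C, hC⟩ := hs.exists_bound_of_continuousOn hh.continuous.continuousOn
  refine ⟨max K C, le_max_of_le_left K.2, fun x y u hx hy hu =>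
    (hC _ (hmem x y u hx hy hu)).trans (le_max_right _ _), ?_⟩
  intro x y u x' y' u' hx hy hu hx' hy' hu'
  have h1 := hK.dist_le_mul _ (hmem x y u hx hy hu) _ (hmem x' y' u' hx' hy' hu')
  rw [dist_eq_norm] at h1
  refine h1.trans (mul_le_mul (le_max_left _ _) ?_ dist_nonneg (le_max_of_le_left K.2))
  rw [Prod.dist_eq, Prod.dist_eq, dist_eq_norm, Real.dist_eq, Real.dist_eq]
  refine max_le ?_ (max_le ?_ ?_) <;>
    linarith [norm_nonneg (x - x'), abs_nonneg (y - y'), abs_nonneg (u - u')]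

theorem SmoothXYU.hasDerivAt (hh : SmoothXYU h) (x : XSpace d) (y u : ℝ) :
    HasDerivAt (h x y)
      (fderiv ℝ (fun p : XSpace d × ℝ × ℝ => h p.1 p.2.1 p.2.2) (x, y, u) (0, 0, 1)) u := by
  have h1 := ((hh.differentiable (by simp)) (x, y, u)).hasFDerivAt
  have h2 : HasDerivAt (fun v : ℝ => ((x, y, v) : XSpace d × ℝ × ℝ)) (0, 0, 1) u :=
    (hasDerivAt_const u x).prodMk ((hasDerivAt_const u y).prodMk (hasDerivAt_id u))
  exact h1.comp_hasDerivAt u h2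

theorem SmoothXYU.deriv_switch (hh : SmoothXYU h) :
    SmoothXYU (fun x y u => deriv (h x y) u) := by
  have h1 : ContDiff ℝ ∞ fun p : XSpace d × ℝ × ℝ =>
      fderiv ℝ (fun p : XSpace d × ℝ × ℝ => h p.1 p.2.1 p.2.2) p (0, 0, 1) :=
    (hh.fderiv_right (by simp)).clm_apply contDiff_const
  have h2 : (fun p : XSpace d × ℝ × ℝ => deriv (h p.1 p.2.1) p.2.2) = fun p =>
      fderiv ℝ (fun p : XSpace d × ℝ × ℝ => h p.1 p.2.1 p.2.2) p (0, 0, 1) :=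
    funext fun p => (hh.hasDerivAt p.1 p.2.1 p.2.2).deriv
  rwa [SmoothXYU, h2]

/-- The divided difference `(h(x, 0; u) - h(x, 0; v)) / (u - v)`, extended to `u = v` by the
partial derivative in the switching quantity. -/
noncomputable def dividedDiff (h : XSpace d → ℝ → ℝ → F) (x : XSpace d) (v u : ℝ) : F :=
  ∫ s in (0 : ℝ)..1, deriv (h x 0) (v + s * (u - v))

theorem SmoothXYU.continuous_deriv_segment (hh : SmoothXYU h) (x : XSpace d) (v u : ℝ) :
    Continuous fun s : ℝ => deriv (h x 0) (v + s * (u - v)) :=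
  hh.deriv_switch.continuous.comp
    (by fun_prop : Continuous fun s : ℝ => ((x, 0, v + s * (u - v)) : XSpace d × ℝ × ℝ))

/-- The fundamental theorem of calculus along the segment from `v` to `u`. -/
theorem SmoothXYU.sub_eq_smul_dividedDiff [CompleteSpace F] (hh : SmoothXYU h) (x : XSpace d)
    (v u : ℝ) : h x 0 u - h x 0 v = (u - v) • dividedDiff h x v u := by
  have hd : ∀ s ∈ uIcc (0 : ℝ) 1, HasDerivAt (fun s : ℝ => h x 0 (v + s * (u - v)))
      ((u - v) • deriv (h x 0) (v + s * (u - v))) s := by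
    intro s _
    have h1 : HasDerivAt (fun s : ℝ => v + s * (u - v)) (u - v) s := by
      simpa using ((hasDerivAt_id s).mul_const (u - v)).const_add v
    have h2 := (hh.hasDerivAt x 0 (v + s * (u - v))).differentiableAt.hasDerivAt
    exact h2.scomp s h1
  have h3 := intervalIntegral.integral_eq_sub_of_hasDerivAt hd
    (((hh.continuous_deriv_segment x v u).const_smul (u - v)).intervalIntegrable 0 1)
  rw [intervalIntegral.integral_smul] at h3
  rw [dividedDiff, h3]
  simp

theorem segment_mem_Icc {u v s : ℝ} (hv : v ∈ Icc (-1 : ℝ) 1) (hu : u ∈ Icc (-1 : ℝ) 1)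
    (hs : s ∈ Icc (0 : ℝ) 1) : v + s * (u - v) ∈ Icc (-1 : ℝ) 1 :=
  (convex_Icc (-1 : ℝ) 1).add_smul_sub_mem hv hu hs

/-- The divided difference averages `∂h/∂u` over a segment inside `[-1, 1]`, so it inherits the
constant of the derivative. -/
theorem SmoothXYU.dividedDiff_bound_lipschitz (hh : SmoothXYU h) (M : ℝ) :
    ∃ C : ℝ, 0 ≤ C ∧
      (∀ x v u, ‖x‖ ≤ M → v ∈ Icc (-1 : ℝ) 1 → u ∈ Icc (-1 : ℝ) 1 →
        ‖dividedDiff h x v u‖ ≤ C) ∧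
      ∀ x v u x' v' u', ‖x‖ ≤ M → v ∈ Icc (-1 : ℝ) 1 → u ∈ Icc (-1 : ℝ) 1 →
        ‖x'‖ ≤ M → v' ∈ Icc (-1 : ℝ) 1 → u' ∈ Icc (-1 : ℝ) 1 →
        ‖dividedDiff h x v u - dividedDiff h x' v' u'‖ ≤
          C * (‖x - x'‖ + |v - v'| + |u - u'|) := by
  obtain ⟨C, hC, hb, hl⟩ := hh.deriv_switch.exists_bound_lipschitz M
  have h0 : (0 : ℝ) ∈ Icc (-1 : ℝ) 1 := by norm_num
  have hI : ∀ {s : ℝ}, s ∈ uIoc (0 : ℝ) 1 → s ∈ Icc (0 : ℝ) 1 := fun hs => by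
    rw [uIoc_of_le zero_le_one] at hs
    exact Ioc_subset_Icc_self hs
  refine ⟨C, hC, fun x v u hx hv hu => ?_, fun x v u x' v' u' hx hv hu hx' hv' hu' => ?_⟩
  · have := intervalIntegral.norm_integral_le_of_norm_le_const (a := (0 : ℝ)) (b := 1) (C := C)
      (f := fun s => deriv (h x 0) (v + s * (u - v)))
      fun s hs => hb x 0 _ hx h0 (segment_mem_Icc hv hu (hI hs))
    simpa [dividedDiff] using this
  · rw [dividedDiff, dividedDiff, ← intervalIntegral.integral_sub
      ((hh.continuous_deriv_segment x v u).intervalIntegrable 0 1)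
      ((hh.continuous_deriv_segment x' v' u').intervalIntegrable 0 1)]
    have := intervalIntegral.norm_integral_le_of_norm_le_const (a := (0 : ℝ)) (b := 1)
      (C := C * (‖x - x'‖ + |v - v'| + |u - u'|))
      (f := fun s => deriv (h x 0) (v + s * (u - v)) - deriv (h x' 0) (v' + s * (u' - v'))) ?_
    · simpa using this
    intro s hs
    have hs := hI hs
    refine (hl x 0 _ x' 0 _ hx h0 (segment_mem_Icc hv hu hs) hx' h0
      (segment_mem_Icc hv' hu' hs)).trans ?_
    have e : v + s * (u - v) - (v' + s * (u' - v')) = (1 - s) * (v - v') + s * (u - u') := by ring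
    have h1 : |v + s * (u - v) - (v' + s * (u' - v'))| ≤ |v - v'| + |u - u'| := by
      rw [e]
      refine (abs_add_le _ _).trans ?_
      rw [abs_mul, abs_mul, abs_of_nonneg hs.1, abs_of_nonneg (sub_nonneg.2 hs.2)]
      nlinarith [hs.1, hs.2, abs_nonneg (v - v'), abs_nonneg (u - u')]
    refine mul_le_mul_of_nonneg_left ?_ hC
    simp only [sub_self, abs_zero]
    linarith

end SmoothFunctions

/-! ### The equivalent control and the multiplier `H`. -/

section Sliding

variable {d : ℕ} {f : XSpace d → ℝ → ℝ → XSpace d} {g : XSpace d → ℝ → ℝ → ℝ} {M : ℝ}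

theorem SlidingCondition.exists_deriv_le (hg : SmoothXYU g) (hs : SlidingCondition g M) :
    ∃ c : ℝ, 0 < c ∧ ∀ x u, ‖x‖ ≤ M → u ∈ Icc (-1 : ℝ) 1 → deriv (g x 0) u ≤ -c := by
  have hK : IsCompact (Metric.closedBall (0 : XSpace d) M ×ˢ Icc (-1 : ℝ) 1) :=
    (isCompact_closedBall _ _).prod isCompact_Icc
  have hc : Continuous fun p : XSpace d × ℝ => -deriv (g p.1 0) p.2 :=
    (hg.deriv_switch.continuous.comp
      (by fun_prop : Continuous fun p : XSpace d × ℝ => ((p.1, 0, p.2) : XSpace d × ℝ × ℝ))).neg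
  obtain ⟨c, hc0, hc1⟩ := hK.exists_forall_le' hc.continuousOn (a := 0) fun p hp =>
    neg_pos.2 (hs.deriv_neg p.1 (by simpa using hp.1) p.2 hp.2)
  exact ⟨c, hc0, fun x u hx hu => by
    linarith [hc1 (x, u) ⟨by simpa using hx, hu⟩]⟩

theorem dividedDiff_le_of_deriv_le (hg : SmoothXYU g) {c : ℝ}
    (hc : ∀ x u, ‖x‖ ≤ M → u ∈ Icc (-1 : ℝ) 1 → deriv (g x 0) u ≤ -c) {x : XSpace d} {v u : ℝ}
    (hx : ‖x‖ ≤ M) (hv : v ∈ Icc (-1 : ℝ) 1) (hu : u ∈ Icc (-1 : ℝ) 1) :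
    dividedDiff g x v u ≤ -c := by
  have := intervalIntegral.integral_mono_on (zero_le_one (α := ℝ))
    ((hg.continuous_deriv_segment x v u).intervalIntegrable 0 1)
    (intervalIntegrable_const (μ := MeasureTheory.volume) (c := -c))
    fun s hs => hc x _ hx (segment_mem_Icc hv hu hs)
  simpa [dividedDiff] using this

theorem equivalentControl_mem (hg : SmoothXYU g) (hs : SlidingCondition g M) {x : XSpace d}
    (hx : ‖x‖ ≤ M) : equivalentControl g x ∈ Icc (-1 : ℝ) 1 :=
  ((equivalentControl_unique hg hs hx _).2 rfl).1

theorem apply_equivalentControl (hg : SmoothXYU g) (hs : SlidingCondition g M) {x : XSpace d}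
    (hx : ‖x‖ ≤ M) : g x 0 (equivalentControl g x) = 0 :=
  ((equivalentControl_unique hg hs hx _).2 rfl).2

/-- A quantitative implicit function argument: `g(x,0;U(x'))` is `O(‖x - x'‖)` because
`g(x',0;U(x')) = 0`, and it is at least `c |U(x) - U(x')|` in size because `∂g/∂u ≤ -c`. -/
theorem equivalentControl_lipschitz (hg : SmoothXYU g) (hs : SlidingCondition g M) :
    ∃ C : ℝ, 0 ≤ C ∧ ∀ x x', ‖x‖ ≤ M → ‖x'‖ ≤ M →
      |equivalentControl g x - equivalentControl g x'| ≤ C * ‖x - x'‖ := by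
  obtain ⟨c, hc, hd⟩ := hs.exists_deriv_le hg
  obtain ⟨C, hC, -, hl⟩ := hg.exists_bound_lipschitz M
  refine ⟨C / c, by positivity, fun x x' hx hx' => ?_⟩
  have hU := equivalentControl_mem hg hs hx
  have hU' := equivalentControl_mem hg hs hx'
  have h0 : (0 : ℝ) ∈ Icc (-1 : ℝ) 1 := by norm_num
  have h1 := hg.sub_eq_smul_dividedDiff x (equivalentControl g x') (equivalentControl g x)
  have h2 := hl x' 0 _ x 0 _ hx' h0 hU' hx h0 hU'
  have h3 := dividedDiff_le_of_deriv_le hg hd hx hU' hU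
  rw [apply_equivalentControl hg hs hx, smul_eq_mul] at h1
  rw [apply_equivalentControl hg hs hx', zero_sub, Real.norm_eq_abs, abs_neg] at h2
  have h4 : |g x 0 (equivalentControl g x')| =
      |equivalentControl g x - equivalentControl g x'| *
        |dividedDiff g x (equivalentControl g x') (equivalentControl g x)| := by
    rw [← abs_mul, ← h1, zero_sub, abs_neg]
  have h5 : c ≤ |dividedDiff g x (equivalentControl g x') (equivalentControl g x)| := by
    rw [abs_of_neg (by linarith)]; linarith
  rw [div_mul_eq_mul_div, le_div_iff₀ hc]
  rw [norm_sub_rev x' x] at h2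
  simp only [sub_self, abs_zero, add_zero] at h2
  calc _ ≤ |equivalentControl g x - equivalentControl g x'| * _ :=
        mul_le_mul_of_nonneg_left h5 (abs_nonneg _)
    _ ≤ _ := h4 ▸ h2

theorem utkinField_lipschitz (hf : SmoothXYU f) (hg : SmoothXYU g) (hs : SlidingCondition g M) :
    ∃ C : ℝ, 0 ≤ C ∧ ∀ x x', ‖x‖ ≤ M → ‖x'‖ ≤ M →
      ‖utkinField f g x - utkinField f g x'‖ ≤ C * ‖x - x'‖ := by
  obtain ⟨A, hA, hU⟩ := equivalentControl_lipschitz hg hs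
  obtain ⟨C, hC, -, hl⟩ := hf.exists_bound_lipschitz M
  have h0 : (0 : ℝ) ∈ Icc (-1 : ℝ) 1 := by norm_num
  refine ⟨C * (1 + A), by positivity, fun x x' hx hx' => ?_⟩
  refine (hl x 0 _ x' 0 _ hx h0 (equivalentControl_mem hg hs hx) hx' h0
    (equivalentControl_mem hg hs hx')).trans ?_
  rw [mul_assoc]
  refine mul_le_mul_of_nonneg_left ?_ hC
  simp only [sub_self, abs_zero]
  linarith [hU x x' hx hx']

/-- On `y = 0`, the deviation of `f` from the sliding vector field is a Lipschitz multiple of the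
normal velocity `g`. -/
theorem exists_sliding_multiplier (hf : SmoothXYU f) (hg : SmoothXYU g)
    (hs : SlidingCondition g M) :
    ∃ H : XSpace d → ℝ → XSpace d, ∃ C : ℝ, 0 ≤ C ∧
      (∀ x u, ‖x‖ ≤ M → u ∈ Icc (-1 : ℝ) 1 →
        f x 0 u - utkinField f g x = g x 0 u • H x u) ∧
      (∀ x u, ‖x‖ ≤ M → u ∈ Icc (-1 : ℝ) 1 → ‖H x u‖ ≤ C) ∧
      ∀ x u x' u', ‖x‖ ≤ M → u ∈ Icc (-1 : ℝ) 1 → ‖x'‖ ≤ M → u' ∈ Icc (-1 : ℝ) 1 →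
        ‖H x u - H x' u'‖ ≤ C * (‖x - x'‖ + |u - u'|) := by
  obtain ⟨A, hA, hU⟩ := equivalentControl_lipschitz hg hs
  obtain ⟨c, hc, hd⟩ := hs.exists_deriv_le hg
  obtain ⟨B, hB, hBb, hBl⟩ := hf.dividedDiff_bound_lipschitz M
  obtain ⟨D, hD, -, hDl⟩ := hg.dividedDiff_bound_lipschitz M
  set U := equivalentControl g
  set p : XSpace d → ℝ → XSpace d := fun x u => dividedDiff f x (U x) u
  set q : XSpace d → ℝ → ℝ := fun x u => dividedDiff g x (U x) u
  have hUm : ∀ {x}, ‖x‖ ≤ M → U x ∈ Icc (-1 : ℝ) 1 := equivalentControl_mem hg hs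
  have hq : ∀ {x u}, ‖x‖ ≤ M → u ∈ Icc (-1 : ℝ) 1 → q x u ≤ -c := fun hx hu =>
    dividedDiff_le_of_deriv_le hg hd hx (hUm hx) hu
  have hqi : ∀ {x u}, ‖x‖ ≤ M → u ∈ Icc (-1 : ℝ) 1 → |(q x u)⁻¹| ≤ c⁻¹ := fun hx hu => by
    rw [abs_inv, abs_of_neg (by linarith [hq hx hu])]
    exact inv_anti₀ hc (by linarith [hq hx hu])
  have hpb : ∀ {x u}, ‖x‖ ≤ M → u ∈ Icc (-1 : ℝ) 1 → ‖p x u‖ ≤ B := fun hx hu =>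
    hBb _ _ _ hx (hUm hx) hu
  -- `H` is the quotient of the divided differences of `f` and `g` based at `U(x)`. The first
  -- summand of the constant bounds `‖H‖`; the other two come from varying numerator and denominator
  -- separately.
  refine ⟨fun x u => (q x u)⁻¹ • p x u, c⁻¹ * B + c⁻¹ * (B * (1 + A)) +
    c⁻¹ * c⁻¹ * (D * (1 + A)) * B, by positivity, fun x u hx hu => ?_, fun x u hx hu => ?_,
    fun x u x' u' hx hu hx' hu' => ?_⟩
  · have hq0 : q x u ≠ 0 := by linarith [hq hx hu]
    have h1 : g x 0 u = (u - U x) * q x u := by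
      have := hg.sub_eq_smul_dividedDiff x (U x) u
      rwa [apply_equivalentControl hg hs hx, sub_zero] at this
    rw [utkinField, hf.sub_eq_smul_dividedDiff x (U x) u, h1, smul_smul, mul_assoc,
      mul_inv_cancel₀ hq0, mul_one]
  · rw [norm_smul, Real.norm_eq_abs]
    refine (mul_le_mul (hqi hx hu) (hpb hx hu) (norm_nonneg _) (by positivity)).trans ?_
    have h1 : 0 ≤ c⁻¹ * (B * (1 + A)) := by positivity
    have h2 : 0 ≤ c⁻¹ * c⁻¹ * (D * (1 + A)) * B := by positivity
    linarith
  · set r := ‖x - x'‖ + |u - u'|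
    have hr : 0 ≤ r := by positivity
    have hr' : ‖x - x'‖ + |U x - U x'| + |u - u'| ≤ (1 + A) * r := by
      have h1 := hU x x' hx hx'
      have h2 : 0 ≤ A * |u - u'| := by positivity
      simp only [r]
      linarith
    have hp2 : ‖p x u - p x' u'‖ ≤ B * (1 + A) * r :=
      (hBl _ _ _ _ _ _ hx (hUm hx) hu hx' (hUm hx') hu').trans
        ((mul_le_mul_of_nonneg_left hr' hB).trans_eq (mul_assoc _ _ _).symm)
    have hq2 : |q x u - q x' u'| ≤ D * (1 + A) * r :=
      (hDl _ _ _ _ _ _ hx (hUm hx) hu hx' (hUm hx') hu').trans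
        ((mul_le_mul_of_nonneg_left hr' hD).trans_eq (mul_assoc _ _ _).symm)
    have hq0 : q x u ≠ 0 := by linarith [hq hx hu]
    have hq0' : q x' u' ≠ 0 := by linarith [hq hx' hu']
    have hqq : |(q x u)⁻¹ - (q x' u')⁻¹| ≤ c⁻¹ * c⁻¹ * (D * (1 + A) * r) := by
      have e : (q x u)⁻¹ - (q x' u')⁻¹ = -((q x u)⁻¹ * (q x' u')⁻¹ * (q x u - q x' u')) := by
        field_simp
        ring
      rw [e, abs_neg, abs_mul, abs_mul]
      exact mul_le_mul (mul_le_mul (hqi hx hu) (hqi hx' hu') (abs_nonneg _) (by positivity)) hq2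
        (abs_nonneg _) (by positivity)
    have e : (q x u)⁻¹ • p x u - (q x' u')⁻¹ • p x' u' =
        (q x u)⁻¹ • (p x u - p x' u') + ((q x u)⁻¹ - (q x' u')⁻¹) • p x' u' := by module
    have h1 : ‖(q x u)⁻¹ • (p x u - p x' u')‖ ≤ c⁻¹ * (B * (1 + A) * r) := by
      rw [norm_smul]
      exact mul_le_mul (hqi hx hu) hp2 (norm_nonneg _) (by positivity)
    have h2 : ‖((q x u)⁻¹ - (q x' u')⁻¹) • p x' u'‖ ≤ c⁻¹ * c⁻¹ * (D * (1 + A) * r) * B := by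
      rw [norm_smul]
      exact mul_le_mul hqq (hpb hx' hu') (norm_nonneg _) (by positivity)
    rw [e]
    refine (norm_add_le _ _).trans ((add_le_add h1 h2).trans ?_)
    have h3 : 0 ≤ c⁻¹ * B * r := by positivity
    linarith

end Sliding

/-! ### Absorbing the term `y' • h(x, y)` into a total derivative. -/

section Averaging

variable {E : Type*} [NormedAddCommGroup E] [NormedSpace ℝ E]

theorem norm_integral_sub_integral_le {h : E → ℝ → E} (hc : ∀ x, Continuous (h x)) {C : ℝ}
    (hl : ∀ x x' s, ‖h x s - h x' s‖ ≤ C * ‖x - x'‖) (x x' : E) (y : ℝ) :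
    ‖(∫ s in (0 : ℝ)..y, h x s) - ∫ s in (0 : ℝ)..y, h x' s‖ ≤ C * ‖x - x'‖ * |y| := by
  rw [← intervalIntegral.integral_sub ((hc x).intervalIntegrable _ _)
    ((hc x').intervalIntegrable _ _)]
  simpa using intervalIntegral.norm_integral_le_of_norm_le_const (a := (0 : ℝ)) (b := y)
    (f := fun s => h x s - h x' s) fun s _ => hl x x' s

theorem continuousOn_integral_comp {h : E → ℝ → E} (hc : ∀ x, Continuous (h x)) {C : ℝ}
    (hl : ∀ x x' s, ‖h x s - h x' s‖ ≤ C * ‖x - x'‖) {s : Set ℝ} {x : ℝ → E} {y : ℝ → ℝ}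
    (hx : ContinuousOn x s) (hy : ContinuousOn y s) :
    ContinuousOn (fun t => ∫ r in (0 : ℝ)..y t, h (x t) r) s := by
  intro t ht
  have h1 : Continuous fun w : ℝ => ∫ r in (0 : ℝ)..w, h (x t) r :=
    intervalIntegral.continuous_primitive (fun a b => (hc (x t)).intervalIntegrable a b) 0
  have h2 : Tendsto (fun τ => ∫ r in (0 : ℝ)..y τ, h (x t) r) (𝓝[s] t)
      (𝓝 (∫ r in (0 : ℝ)..y t, h (x t) r)) := (h1.tendsto _).comp (hy t ht)
  have h3 : Tendsto (fun τ => C * ‖x τ - x t‖ * |y τ|) (𝓝[s] t) (𝓝 0) := by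
    have := (((hx t ht).sub_const (x t)).norm.const_mul C).mul (hy t ht).abs
    simpa [ContinuousWithinAt] using this
  have h4 := squeeze_zero_norm (fun τ => norm_integral_sub_integral_le hc hl (x τ) (x t) (y τ)) h3
  simpa [ContinuousWithinAt] using h4.add h2

theorem gronwallBound_mul (δ K ε a t : ℝ) :
    gronwallBound (δ * a) K (ε * a) t = gronwallBound δ K ε t * a := by
  unfold gronwallBound
  split_ifs <;> ring

/-- Grönwall estimate for a trajectory whose velocity deviates from a reference field by a small
error plus a term `y' • h(x, y)`, where `y` stays in `[-α, α]`: up to `O(α)` that term is the total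
derivative of `∫ s in 0..y, h(x, s)`. -/
theorem norm_sub_le_of_oscillating_perturbation [CompleteSpace E] {h : E → ℝ → E} (hc : ∀ x, Continuous (h x))
    {A B C V α T : ℝ} (hA : 0 ≤ A) (hB : 0 ≤ B) (hC : 0 ≤ C) (hV : 0 ≤ V) (hα : 0 ≤ α)
    (hb : ∀ x s, ‖h x s‖ ≤ C) (hl : ∀ x x' s, ‖h x s - h x' s‖ ≤ C * ‖x - x'‖)
    {x vx z vz : ℝ → E} {y vy : ℝ → ℝ}
    (hx : ∀ t ∈ Icc 0 T, HasDerivWithinAt x (vx t) (Icc 0 T) t)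
    (hy : ∀ t ∈ Icc 0 T, HasDerivWithinAt y (vy t) (Icc 0 T) t)
    (hz : ∀ t ∈ Icc 0 T, HasDerivWithinAt z (vz t) (Icc 0 T) t)
    (hyα : ∀ t ∈ Icc 0 T, |y t| ≤ α) (hvx : ∀ t ∈ Icc 0 T, ‖vx t‖ ≤ V)
    (hv : ∀ t ∈ Icc 0 T, ‖vx t - vz t - vy t • h (x t) (y t)‖ ≤ A * ‖x t - z t‖ + B * α)
    (h0 : x 0 = z 0) :
    ∀ t ∈ Icc 0 T,
      ‖x t - z t‖ ≤ (C + gronwallBound C A (A * C + B + C * V) T) * α := by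
  -- The corrector, of size at most `C * α`.
  set k : ℝ → E := fun t => ∫ s in (0 : ℝ)..y t, h (x t) s
  have hk : ∀ t ∈ Icc 0 T, ‖k t‖ ≤ C * α := fun t ht => by
    have := intervalIntegral.norm_integral_le_of_norm_le_const (a := (0 : ℝ)) (b := y t)
      (f := h (x t)) fun s _ => hb (x t) s
    rw [sub_zero] at this
    exact this.trans (mul_le_mul_of_nonneg_left (hyα t ht) hC)
  have hxc : ContinuousOn x (Icc 0 T) := fun t ht => (hx t ht).continuousWithinAt
  have hyc : ContinuousOn y (Icc 0 T) := fun t ht => (hy t ht).continuousWithinAt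
  have hzc : ContinuousOn z (Icc 0 T) := fun t ht => (hz t ht).continuousWithinAt
  have key : ∀ t ∈ Icc 0 T, ‖x t - z t - k t‖ ≤
      gronwallBound (C * α) A ((A * C + B + C * V) * α) (t - 0) := by
    intro t₁ ht₁
    -- As `h` is only Lipschitz in `x`, `k` may fail to be differentiable; a bound on right
    -- difference quotients suffices for Grönwall.
    refine le_gronwallBound_of_liminf_deriv_right_le (f := fun t => ‖x t - z t - k t‖)
      (f' := fun t => ‖vx t - vz t - vy t • h (x t) (y t)‖ + C * α * ‖vx t‖) (b := T)
      ((hxc.sub hzc).sub (continuousOn_integral_comp hc hl hxc hyc)).norm ?_ ?_ ?_ t₁ ht₁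
    · intro t ht r hr
      have htI : t ∈ Icc 0 T := Ico_subset_Icc_self ht
      have hIcc : Icc 0 T ∈ 𝓝[>] t := Icc_mem_nhdsGT_of_mem ht
      -- Freezing the first argument of `h` at time `t` makes the corrected difference
      -- differentiable at `t`. The error at `τ` is at most `C * α * ‖x τ - x t‖`, whence the
      -- summand `C * α * ‖vx t‖` in `f'`.
      set Z : ℝ → E := fun τ => x τ - z τ - ∫ s in (0 : ℝ)..y τ, h (x t) s
      have hprim : HasDerivAt (fun w : ℝ => ∫ s in (0 : ℝ)..w, h (x t) s) (h (x t) (y t)) (y t) :=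
        intervalIntegral.integral_hasDerivAt_right ((hc (x t)).intervalIntegrable _ _)
          ((hc (x t)).stronglyMeasurableAtFilter _ _) (hc (x t)).continuousAt
      have hxd : HasDerivWithinAt x (vx t) (Ioi t) t := (hx t htI).mono_of_mem_nhdsWithin hIcc
      have hyd : HasDerivWithinAt y (vy t) (Ioi t) t := (hy t htI).mono_of_mem_nhdsWithin hIcc
      have hzd : HasDerivWithinAt z (vz t) (Ioi t) t := (hz t htI).mono_of_mem_nhdsWithin hIcc
      have hZ : HasDerivWithinAt Z (vx t - vz t - vy t • h (x t) (y t)) (Ioi t) t :=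
        (hxd.sub hzd).sub (hprim.scomp_hasDerivWithinAt t hyd)
      have hZs := (hasDerivWithinAt_iff_tendsto_slope' (lt_irrefl t)).1 hZ
      have hxs := (hasDerivWithinAt_iff_tendsto_slope' (lt_irrefl t)).1 hxd
      have hlim := hZs.norm.add (hxs.norm.const_mul (C * α))
      refine Eventually.frequently ?_
      filter_upwards [hlim.eventually_lt_const hr, hIcc, self_mem_nhdsWithin] with τ h1 hτ hτt
      refine lt_of_le_of_lt ?_ h1
      have hpos : 0 < τ - t := sub_pos.2 hτt
      have e : (x τ - z τ - k τ) - (x t - z t - k t) =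
          (Z τ - Z t) - (k τ - ∫ s in (0 : ℝ)..y τ, h (x t) s) := by
        simp only [Z, k]
        abel
      have h2 : ‖k τ - ∫ s in (0 : ℝ)..y τ, h (x t) s‖ ≤ C * α * ‖x τ - x t‖ := by
        refine (norm_integral_sub_integral_le hc hl (x τ) (x t) (y τ)).trans ?_
        rw [mul_right_comm]
        exact mul_le_mul_of_nonneg_right (mul_le_mul_of_nonneg_left (hyα τ hτ) hC) (norm_nonneg _)
      have h3 : ‖x τ - z τ - k τ‖ - ‖x t - z t - k t‖ ≤ ‖Z τ - Z t‖ + C * α * ‖x τ - x t‖ :=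
        (norm_sub_norm_le _ _).trans (e ▸ (norm_sub_le _ _).trans (by gcongr))
      simp only [slope, vsub_eq_sub, norm_smul, norm_inv, Real.norm_eq_abs, abs_of_pos hpos]
      calc _ ≤ (τ - t)⁻¹ * (‖Z τ - Z t‖ + C * α * ‖x τ - x t‖) :=
            mul_le_mul_of_nonneg_left h3 (inv_nonneg.2 hpos.le)
        _ = _ := by ring
    · have h0T : (0 : ℝ) ∈ Icc 0 T := ⟨le_rfl, ht₁.1.trans ht₁.2⟩
      simpa [h0] using hk 0 h0T
    · intro t ht
      have htI : t ∈ Icc 0 T := Ico_subset_Icc_self ht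
      have h1 : ‖x t - z t‖ ≤ ‖x t - z t - k t‖ + C * α := by
        have := norm_add_le (x t - z t - k t) (k t)
        rw [sub_add_cancel] at this
        linarith [hk t htI]
      have h2 := mul_le_mul_of_nonneg_left h1 hA
      have h3 := mul_le_mul_of_nonneg_left (hvx t htI) (mul_nonneg hC hα)
      linarith [hv t htI]
  intro t ht
  have h1 : ‖x t - z t‖ ≤ ‖x t - z t - k t‖ + C * α := by
    have := norm_add_le (x t - z t - k t) (k t)
    rw [sub_add_cancel] at this
    linarith [hk t ht]
  have h2 := key t ht
  rw [gronwallBound_mul, sub_zero] at h2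
  have h3 := mul_le_mul_of_nonneg_right
    (gronwallBound_mono hC (by positivity : 0 ≤ A * C + B + C * V) hA ht.2) hα
  linarith

end Averaging

/-! ### Existence, uniqueness and an invariant interval. -/

section ODE

variable {E : Type*} [NormedAddCommGroup E] [NormedSpace ℝ E]

/-- With speed at most `C`, no trajectory leaves the ball of radius `C * T` by time `T`, so a single
Picard–Lindelöf step covers the whole interval. -/
theorem exists_solution_of_bounded_locallyLipschitz [ProperSpace E] {v : E → E}
    (hv : LocallyLipschitz v) {C : ℝ} (hC : ∀ x, ‖v x‖ ≤ C) {T : ℝ} (hT : 0 ≤ T) (x₀ : E) :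
    ∃ x : ℝ → E, x 0 = x₀ ∧ ∀ t ∈ Icc 0 T, HasDerivWithinAt x (v (x t)) (Icc 0 T) t := by
  have hC0 : 0 ≤ C := (norm_nonneg _).trans (hC x₀)
  lift C to NNReal using hC0
  lift T to NNReal using hT
  obtain ⟨K, hK⟩ := (hv.locallyLipschitzOn (s := Metric.closedBall x₀ (C * T : NNReal))
    ).exists_lipschitzOnWith_of_compact (isCompact_closedBall _ _)
  have hPL : IsPicardLindelof (fun _ => v) (tmin := 0) (tmax := T) ⟨0, le_rfl, T.2⟩ x₀
      (C * T) 0 C K :=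
    { lipschitzOnWith := fun _ _ => hK
      continuousOn := fun _ _ => continuousOn_const
      norm_le := fun _ _ x _ => hC x
      mul_max_le := by simp }
  exact hPL.exists_eq_forall_mem_Icc_hasDerivWithinAt₀

/-- Both trajectories have compact image, and on the union of the images `v` is Lipschitz. -/
theorem eqOn_of_locallyLipschitz {v : E → E} (hv : LocallyLipschitz v) {T : ℝ} {x x' : ℝ → E}
    (hx : ∀ t ∈ Icc 0 T, HasDerivWithinAt x (v (x t)) (Icc 0 T) t)
    (hx' : ∀ t ∈ Icc 0 T, HasDerivWithinAt x' (v (x' t)) (Icc 0 T) t) (h0 : x 0 = x' 0) :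
    EqOn x x' (Icc 0 T) := by
  have hc : ContinuousOn x (Icc 0 T) := fun t ht => (hx t ht).continuousWithinAt
  have hc' : ContinuousOn x' (Icc 0 T) := fun t ht => (hx' t ht).continuousWithinAt
  obtain ⟨K, hK⟩ := (hv.locallyLipschitzOn (s := x '' Icc 0 T ∪ x' '' Icc 0 T)
    ).exists_lipschitzOnWith_of_compact
      ((isCompact_Icc.image_of_continuousOn hc).union (isCompact_Icc.image_of_continuousOn hc'))
  exact ODE_solution_unique_of_mem_Icc_right (v := fun _ => v) (fun _ _ => hK) hc
    (fun t ht => (hx t (Ico_subset_Icc_self ht)).mono_of_mem_nhdsWithin (Icc_mem_nhdsGE_of_mem ht))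
    (fun t ht => Or.inl (mem_image_of_mem x (Ico_subset_Icc_self ht))) hc'
    (fun t ht => (hx' t (Ico_subset_Icc_self ht)).mono_of_mem_nhdsWithin
      (Icc_mem_nhdsGE_of_mem ht))
    (fun t ht => Or.inr (mem_image_of_mem x' (Ico_subset_Icc_self ht))) h0

theorem mem_Icc_of_inward {y vy : ℝ → ℝ} {α T : ℝ}
    (hy : ∀ t ∈ Icc 0 T, HasDerivWithinAt y (vy t) (Icc 0 T) t) (h0 : y 0 ∈ Icc (-α) α)
    (hpos : ∀ t ∈ Icc 0 T, y t = α → vy t < 0) (hneg : ∀ t ∈ Icc 0 T, y t = -α → 0 < vy t) :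
    ∀ t ∈ Icc 0 T, y t ∈ Icc (-α) α := by
  have hc : ContinuousOn y (Icc 0 T) := fun t ht => (hy t ht).continuousWithinAt
  have hd : ∀ t ∈ Ico 0 T, HasDerivWithinAt y (vy t) (Ici t) t := fun t ht =>
    (hy t (Ico_subset_Icc_self ht)).mono_of_mem_nhdsWithin (Icc_mem_nhdsGE_of_mem ht)
  intro t ht
  refine ⟨?_, image_le_of_deriv_right_lt_deriv_boundary (B := fun _ => α) (B' := fun _ => 0)
    hc hd h0.2 (fun s => hasDerivAt_const s α)
    (fun s hs h => hpos s (Ico_subset_Icc_self hs) h) ht⟩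
  have := image_le_of_deriv_right_lt_deriv_boundary (f := fun s => -y s) (B := fun _ => α)
    (B' := fun _ => 0) hc.neg (fun s hs => (hd s hs).neg) (by linarith [h0.1])
    (fun s => hasDerivAt_const s α)
    (fun s hs h => by linarith [hneg s (Ico_subset_Icc_self hs) (by linarith)]) ht
  linarith

end ODE

/-! ### The truncated system and its estimate. -/

section Truncation

theorem IsSmoothSwitch.mem_Icc' {φ : ℝ → ℝ} (hφ : IsSmoothSwitch φ) (w : ℝ) :
    φ w ∈ Icc (-1 : ℝ) 1 := by
  rcases le_or_gt |w| 1 with h | h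
  · exact hφ.mem_Icc w h
  · rw [hφ.eq_sign w h]
    rcases Real.sign_apply_eq w with h | h | h <;> rw [h] <;> norm_num

/-- The sign condition covers only `|w| > 1`; continuity supplies the endpoint. -/
theorem IsSmoothSwitch.apply_one {φ : ℝ → ℝ} (hφ : IsSmoothSwitch φ) : φ 1 = 1 := by
  have h1 : Tendsto φ (𝓝[>] 1) (𝓝 (φ 1)) := hφ.smooth.continuous.continuousWithinAt
  have h2 : Tendsto φ (𝓝[>] 1) (𝓝 1) := by
    refine tendsto_const_nhds.congr' ?_
    filter_upwards [self_mem_nhdsWithin] with w (hw : 1 < w)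
    rw [hφ.eq_sign w (hw.trans_le (le_abs_self w)), Real.sign_of_pos (by linarith)]
  exact tendsto_nhds_unique h1 h2

theorem IsSmoothSwitch.apply_neg_one {φ : ℝ → ℝ} (hφ : IsSmoothSwitch φ) : φ (-1) = -1 := by
  have h1 : Tendsto φ (𝓝[<] (-1)) (𝓝 (φ (-1))) := hφ.smooth.continuous.continuousWithinAt
  have h2 : Tendsto φ (𝓝[<] (-1)) (𝓝 (-1)) := by
    refine tendsto_const_nhds.congr' ?_
    filter_upwards [self_mem_nhdsWithin] with w (hw : w < -1)
    rw [hφ.eq_sign w (lt_abs.2 (Or.inr (by linarith))), Real.sign_of_neg (by linarith)]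
  exact tendsto_nhds_unique h1 h2

theorem exists_lipschitz_truncation {E : Type*} [NormedAddCommGroup E] [InnerProductSpace ℝ E]
    [FiniteDimensional ℝ E] {r M : ℝ} (hr : 0 < r) (hrM : r < M) :
    ∃ P : E → E, (∃ K, LipschitzWith K P) ∧ (∀ x, ‖P x‖ ≤ M) ∧ ∀ x, ‖x‖ ≤ r → P x = x := by
  let χ : ContDiffBump (0 : E) := ⟨r, M, hr, hrM⟩
  have hs : HasCompactSupport fun x : E => χ x • x := χ.hasCompactSupport.smul_right
  have hd : ContDiff ℝ 1 fun x : E => χ x • x := χ.contDiff.smul contDiff_id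
  refine ⟨fun x => χ x • x, hd.lipschitzWith_of_hasCompactSupport hs one_ne_zero, fun x => ?_,
    fun x hx => ?_⟩
  · beta_reduce
    rcases le_or_gt M ‖x‖ with h | h
    · rw [χ.zero_of_le_dist (by simpa [χ] using h), zero_smul, norm_zero]
      exact (hr.trans hrM).le
    · rw [norm_smul, Real.norm_eq_abs, abs_of_nonneg χ.nonneg]
      nlinarith [χ.le_one (x := x), norm_nonneg x]
  · beta_reduce
    rw [χ.one_of_mem_closedBall (by simpa [χ] using hx), one_smul]

variable {d : ℕ} {f : XSpace d → ℝ → ℝ → XSpace d} {g : XSpace d → ℝ → ℝ → ℝ} {M : ℝ}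

/-- The strict signs at `y = 0` are uniform on the compact ball, so they survive a displacement `α`
that is small against the Lipschitz constant of `g`. -/
theorem SlidingCondition.exists_inward (hg : SmoothXYU g) (hs : SlidingCondition g M) :
    ∃ α₁ : ℝ, 0 < α₁ ∧ α₁ ≤ 1 ∧ ∀ α, 0 < α → α ≤ α₁ → ∀ x, ‖x‖ ≤ M →
      g x α 1 < 0 ∧ 0 < g x (-α) (-1) := by
  have hK : IsCompact (Metric.closedBall (0 : XSpace d) M) := isCompact_closedBall _ _
  have hc : ∀ u : ℝ, Continuous fun x => g x 0 u := fun u => hg.continuous.comp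
    (by fun_prop : Continuous fun x : XSpace d => ((x, 0, u) : XSpace d × ℝ × ℝ))
  obtain ⟨c, hc0, hc1⟩ := hK.exists_forall_le' (hc 1).neg.continuousOn (a := 0) fun x hx =>
    neg_pos.2 (hs.plus_neg x (by simpa using hx))
  obtain ⟨c', hc0', hc1'⟩ := hK.exists_forall_le' (hc (-1)).continuousOn (a := 0) fun x hx =>
    hs.minus_pos x (by simpa using hx)
  obtain ⟨C, hC, -, hl⟩ := hg.exists_bound_lipschitz M
  set m := min c c' / (C + 1)
  have hm : 0 < m := div_pos (lt_min hc0 hc0') (by linarith)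
  refine ⟨min 1 m, lt_min one_pos hm, min_le_left _ _, fun α hα hα1 x hx => ?_⟩
  have hα1' : α ≤ 1 := hα1.trans (min_le_left _ _)
  have h0 : (0 : ℝ) ∈ Icc (-1 : ℝ) 1 := by norm_num
  have h1 := hl x α 1 x 0 1 hx ⟨by linarith, hα1'⟩ (by norm_num) hx h0 (by norm_num)
  have h2 := hl x (-α) (-1) x 0 (-1) hx ⟨by linarith, by linarith⟩ (by norm_num) hx h0
    (by norm_num)
  have h3 : (C + 1) * α ≤ min c c' := by
    rw [mul_comm, ← le_div_iff₀ (by linarith)]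
    exact hα1.trans (min_le_right _ _)
  simp only [sub_self, norm_zero, abs_zero, sub_zero, zero_add, add_zero, abs_neg,
    abs_of_pos hα, Real.norm_eq_abs] at h1 h2
  have h4 : c ≤ -g x 0 1 := hc1 x (by simpa using hx)
  have h5 := hc1' x (by simpa using hx)
  exact ⟨by linarith [(abs_le.1 h1).2, min_le_left c c'],
    by linarith [(abs_le.1 h2).1, min_le_right c c']⟩

/-- The smoothed vector field with `x` truncated by `P` and `y` clamped to `[-1, 1]`. -/
noncomputable def truncatedField (f : XSpace d → ℝ → ℝ → XSpace d) (g : XSpace d → ℝ → ℝ → ℝ)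
    (φ : ℝ → ℝ) (α : ℝ) (P : XSpace d → XSpace d) (p : XSpace d × ℝ) : XSpace d × ℝ :=
  (f (P p.1) (max (-1) (min 1 p.2)) (φ (p.2 / α)), g (P p.1) (max (-1) (min 1 p.2)) (φ (p.2 / α)))

theorem clamp_mem (y : ℝ) : max (-1) (min 1 y) ∈ Icc (-1 : ℝ) 1 :=
  ⟨le_max_left _ _, max_le (by norm_num) (min_le_left _ _)⟩

theorem clamp_eq {y : ℝ} (hy : y ∈ Icc (-1 : ℝ) 1) : max (-1) (min 1 y) = y := by
  rw [min_eq_right hy.2, max_eq_right hy.1]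

theorem truncatedField_locallyLipschitz (hf : SmoothXYU f) (hg : SmoothXYU g) {φ : ℝ → ℝ}
    (hφ : IsSmoothSwitch φ) (α : ℝ) {P : XSpace d → XSpace d} {K : NNReal}
    (hP : LipschitzWith K P) : LocallyLipschitz (truncatedField f g φ α P) := by
  have h1 : LocallyLipschitz fun p : XSpace d × ℝ => P p.1 :=
    (hP.comp LipschitzWith.prod_fst).locallyLipschitz
  have h2 : LocallyLipschitz fun p : XSpace d × ℝ => max (-1) (min 1 p.2) :=
    (LipschitzWith.prod_snd.locallyLipschitz.const_min 1).const_max (-1)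
  have h3 : LocallyLipschitz fun p : XSpace d × ℝ => φ (p.2 / α) :=
    ((hφ.smooth.of_le (by simp)).comp (contDiff_snd.div_const α)).locallyLipschitz
  have h4 := h1.prodMk (h2.prodMk h3)
  exact ((ContDiff.locallyLipschitz (hf.of_le (by simp))).comp h4).prodMk
    ((ContDiff.locallyLipschitz (hg.of_le (by simp))).comp h4)

theorem smoothedField_locallyLipschitz (hf : SmoothXYU f) (hg : SmoothXYU g) {φ : ℝ → ℝ}
    (hφ : IsSmoothSwitch φ) (α : ℝ) : LocallyLipschitz fun p : XSpace d × ℝ =>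
      (f p.1 p.2 (φ (p.2 / α)), g p.1 p.2 (φ (p.2 / α))) := by
  have h1 : ContDiff ℝ 1 fun p : XSpace d × ℝ => (p.1, p.2, φ (p.2 / α)) :=
    contDiff_fst.prodMk (contDiff_snd.prodMk
      ((hφ.smooth.of_le (by simp)).comp (contDiff_snd.div_const α)))
  have h2 := (hf.of_le (m := 1) (by simp)).comp h1
  have h3 := (hg.of_le (m := 1) (by simp)).comp h1
  exact (h2.prodMk h3).locallyLipschitz

/-- Uniqueness is needed for the original field: an arbitrary solution is not known beforehand to
stay where the truncation is inactive. -/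
theorem IsSmoothedSolution.eqOn (hf : SmoothXYU f) (hg : SmoothXYU g) {φ : ℝ → ℝ}
    (hφ : IsSmoothSwitch φ) {α T : ℝ} {x x' : ℝ → XSpace d} {y y' : ℝ → ℝ}
    (h : IsSmoothedSolution f g φ α T x y) (h' : IsSmoothedSolution f g φ α T x' y')
    (hx : x 0 = x' 0) (hy : y 0 = y' 0) : EqOn x x' (Icc 0 T) := by
  have := eqOn_of_locallyLipschitz (smoothedField_locallyLipschitz hf hg hφ α)
    (x := fun t => (x t, y t)) (x' := fun t => (x' t, y' t)) (T := T)
    (fun t ht => (h t ht).1.prodMk (h t ht).2) (fun t ht => (h' t ht).1.prodMk (h' t ht).2)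
    (Prod.ext hx hy)
  exact fun t ht => congrArg Prod.fst (this ht)

/-- Solutions of the truncated smoothed system starting in the layer `|y| ≤ α` stay in the layer
and within `O(α)` of the sliding solution. -/
theorem exists_truncated_estimate (hf : SmoothXYU f) (hg : SmoothXYU g) (hs : SlidingCondition g M)
    {φ : ℝ → ℝ} (hφ : IsSmoothSwitch φ) {T : ℝ} {xU : ℝ → XSpace d}
    (hxU : IsUtkinSolution f g T xU) {P : XSpace d → XSpace d} {K : NNReal}
    (hP : LipschitzWith K P) (hPM : ∀ x, ‖P x‖ ≤ M) (hPU : ∀ t ∈ Icc 0 T, P (xU t) = xU t) :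
    ∃ α₁ L : ℝ, 0 < α₁ ∧ α₁ ≤ 1 ∧ 0 < L ∧ ∀ α, 0 < α → α ≤ α₁ →
      ∀ (x : ℝ → XSpace d) (y : ℝ → ℝ),
        (∀ t ∈ Icc 0 T, HasDerivWithinAt x (truncatedField f g φ α P (x t, y t)).1 (Icc 0 T) t) →
        (∀ t ∈ Icc 0 T, HasDerivWithinAt y (truncatedField f g φ α P (x t, y t)).2 (Icc 0 T) t) →
        x 0 = xU 0 → y 0 ∈ Icc (-α) α →
        ∀ t ∈ Icc 0 T, y t ∈ Icc (-α) α ∧ ‖x t - xU t‖ ≤ L * α := by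
  obtain ⟨α₁, hα₁, hα₁1, hin⟩ := hs.exists_inward hg
  obtain ⟨H, C, hC, hH, hHb, hHl⟩ := exists_sliding_multiplier hf hg hs
  obtain ⟨A, hA, hUl⟩ := utkinField_lipschitz hf hg hs
  obtain ⟨Cf, hCf, hfb, hfl⟩ := hf.exists_bound_lipschitz M
  obtain ⟨Cg, hCg, -, hgl⟩ := hg.exists_bound_lipschitz M
  have hPl : ∀ x x', ‖P x - P x'‖ ≤ K * ‖x - x'‖ := fun x x' => by
    simpa [dist_eq_norm] using hP.dist_le_mul x x'
  have h0 : (0 : ℝ) ∈ Icc (-1 : ℝ) 1 := by norm_num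
  -- Dominates both the bound `C` of `H` and the Lipschitz constant `C * K` of `H ∘ P` in `x`.
  set D : ℝ := C * (1 + K)
  have hD : 0 ≤ D := by positivity
  have hCD : C ≤ D := le_mul_of_one_le_right hC (by simp)
  set L₀ : ℝ := D + gronwallBound D (A * K) (A * K * D + (Cf + Cg * C) + D * Cf) T
  refine ⟨α₁, max L₀ 1, hα₁, hα₁1, by positivity, fun α hα hαα₁ x y hx hy hx0 hy0 => ?_⟩
  have hα1 : α ≤ 1 := hαα₁.trans hα₁1
  have hlayer : ∀ t ∈ Icc 0 T, y t ∈ Icc (-α) α := by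
    refine mem_Icc_of_inward hy hy0 (fun t ht h => ?_) fun t ht h => ?_
    · simp only [truncatedField]
      rw [h, div_self hα.ne', hφ.apply_one, clamp_eq ⟨by linarith, hα1⟩]
      exact (hin α hα hαα₁ _ (hPM _)).1
    · simp only [truncatedField]
      rw [h, neg_div, div_self hα.ne', hφ.apply_neg_one, clamp_eq ⟨by linarith, by linarith⟩]
      exact (hin α hα hαα₁ _ (hPM _)).2
  refine fun t ht => ⟨hlayer t ht, ?_⟩
  -- Only continuity in `s` is required of `H (P x) (φ (s / α))`, so the steep slope of order `1 /
  -- α` does not enter the constants.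
  have hest := norm_sub_le_of_oscillating_perturbation (h := fun x s => H (P x) (φ (s / α)))
    (A := A * K) (B := Cf + Cg * C) (C := D) (V := Cf) (α := α) (T := T) ?_ (by positivity)
    (by positivity) hD hCf hα.le ?_ ?_ hx hy hxU (fun t ht => abs_le.2 (hlayer t ht)) ?_ ?_ hx0 t ht
  · exact hest.trans (mul_le_mul_of_nonneg_right (le_max_left _ _) hα.le)
  · intro x
    have hHc : ContinuousOn (H (P x)) (Icc (-1 : ℝ) 1) := by
      refine LipschitzOnWith.continuousOn (K := ⟨C, hC⟩) (LipschitzOnWith.of_dist_le_mul ?_)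
      intro u hu u' hu'
      have := hHl (P x) u (P x) u' (hPM x) hu (hPM x) hu'
      rw [sub_self, norm_zero, zero_add] at this
      rwa [dist_eq_norm, Real.dist_eq]
    exact hHc.comp_continuous (hφ.smooth.continuous.comp (continuous_id.div_const α))
      fun s => hφ.mem_Icc' _
  · exact fun x s => (hHb _ _ (hPM x) (hφ.mem_Icc' _)).trans hCD
  · intro x x' s
    have h1 := hHl _ _ _ _ (hPM x) (hφ.mem_Icc' (s / α)) (hPM x') (hφ.mem_Icc' (s / α))
    rw [sub_self, abs_zero, add_zero] at h1
    have h2 := mul_le_mul_of_nonneg_left (hPl x x') hC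
    have h3 : 0 ≤ C * ‖x - x'‖ := by positivity
    simp only [D]
    linarith
  · exact fun t _ => hfb _ _ _ (hPM _) (clamp_mem _) (hφ.mem_Icc' _)
  · intro t ht
    have hyt := hlayer t ht
    have hy1 : y t ∈ Icc (-1 : ℝ) 1 := ⟨by linarith [hyt.1], by linarith [hyt.2]⟩
    have hyα : |y t| ≤ α := abs_le.2 hyt
    simp only [truncatedField, clamp_eq hy1]
    set u := φ (y t / α)
    have hu : u ∈ Icc (-1 : ℝ) 1 := hφ.mem_Icc' _
    set p := P (x t) with hp
    have hpM : ‖p‖ ≤ M := hPM _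
    -- The multiplier identity holds at `y = 0`; moving `f` and `g` there costs `O(α)` each, and the
    -- middle difference feeds Grönwall.
    have e : f p (y t) u - utkinField f g (xU t) - g p (y t) u • H p u =
        (f p (y t) u - f p 0 u) + (utkinField f g p - utkinField f g (xU t)) +
          (g p 0 u - g p (y t) u) • H p u := by
      rw [sub_smul, ← hH p u hpM hu]
      abel
    have h1 : ‖f p (y t) u - f p 0 u‖ ≤ Cf * α := by
      have := hfl p (y t) u p 0 u hpM hy1 hu hpM h0 hu
      simp only [sub_self, norm_zero, abs_zero, sub_zero, zero_add, add_zero] at this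
      exact this.trans (mul_le_mul_of_nonneg_left hyα hCf)
    have h2 : ‖g p 0 u - g p (y t) u‖ ≤ Cg * α := by
      have := hgl p 0 u p (y t) u hpM h0 hu hpM hy1 hu
      simp only [sub_self, norm_zero, abs_zero, zero_sub, zero_add, add_zero, abs_neg] at this
      exact this.trans (mul_le_mul_of_nonneg_left hyα hCg)
    have h3 : ‖utkinField f g p - utkinField f g (xU t)‖ ≤ A * (K * ‖x t - xU t‖) := by
      have hU := hPU t ht
      have hUM : ‖xU t‖ ≤ M := hU ▸ hPM (xU t)
      refine (hUl p (xU t) hpM hUM).trans (mul_le_mul_of_nonneg_left ?_ hA)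
      have := hPl (x t) (xU t)
      rwa [hU] at this
    have h4 : ‖(g p 0 u - g p (y t) u) • H p u‖ ≤ Cg * α * C := by
      rw [norm_smul]
      exact mul_le_mul h2 (hHb p u hpM hu) (norm_nonneg _) (by positivity)
    rw [e]
    refine (norm_add₃_le).trans ?_
    linarith

end Truncation

/-! ### Removing the truncation. -/

theorem theorem2p2 {d : ℕ} (f : XSpace d → ℝ → ℝ → XSpace d) (g : XSpace d → ℝ → ℝ → ℝ)
    (hf : SmoothXYU f) (hg : SmoothXYU g)
    (M : ℝ) (hM : SlidingCondition g M)
    (φ : ℝ → ℝ) (hφ : IsSmoothSwitch φ)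
    (T : ℝ) (hT : 0 < T)
    (xU : ℝ → XSpace d) (hxU : IsUtkinSolution f g T xU)
    (hxUM : ∀ t ∈ Set.Icc 0 T, ‖xU t‖ < M) :
    ∃ α₀ : ℝ, 0 < α₀ ∧ ∃ L : ℝ, 0 < L ∧
      ∀ α : ℝ, 0 < α → α ≤ α₀ → ∀ y₀ ∈ Set.Icc (-α) α,
        (∃ (x : ℝ → XSpace d) (y : ℝ → ℝ),
          IsSmoothedSolution f g φ α T x y ∧ x 0 = xU 0 ∧ y 0 = y₀) ∧
        ∀ (x : ℝ → XSpace d) (y : ℝ → ℝ),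
          IsSmoothedSolution f g φ α T x y → x 0 = xU 0 → y 0 = y₀ →
            ∀ t ∈ Set.Icc 0 T, ‖x t - xU t‖ ≤ L * α := by
  have hc : ContinuousOn xU (Icc 0 T) := fun t ht => (hxU t ht).continuousWithinAt
  have h0T : (0 : ℝ) ∈ Icc 0 T := ⟨le_rfl, hT.le⟩
  obtain ⟨t₁, ht₁, hmax⟩ := isCompact_Icc.exists_isMaxOn ⟨0, h0T⟩ hc.norm
  have hr₀ : ∀ t ∈ Icc 0 T, ‖xU t‖ ≤ ‖xU t₁‖ := hmax
  -- The gap between the maximum of `‖xU‖` and `r` is room for the `O(α)` deviation; the gap between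
  -- `r` and `M` is where the truncation cuts off.
  obtain ⟨r, hr₁, hrM⟩ := exists_between (hxUM t₁ ht₁)
  obtain ⟨P, ⟨K, hP⟩, hPM, hPr⟩ := exists_lipschitz_truncation (E := XSpace d)
    ((norm_nonneg _).trans_lt hr₁) hrM
  obtain ⟨α₁, L, hα₁, hα₁1, hL, hest⟩ := exists_truncated_estimate hf hg hM hφ hxU hP hPM
    fun t ht => hPr _ ((hr₀ t ht).trans hr₁.le)
  obtain ⟨Cf, -, hfb, -⟩ := hf.exists_bound_lipschitz M
  obtain ⟨Cg, -, hgb, -⟩ := hg.exists_bound_lipschitz M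
  -- The second bound gives `L * α ≤ r - ‖xU t₁‖`, which keeps the truncated solution in the ball of
  -- radius `r`, where `P` is the identity.
  refine ⟨min α₁ ((r - ‖xU t₁‖) / L), lt_min hα₁ (div_pos (sub_pos.2 hr₁) hL), L, hL,
    fun α hα hα₀ y₀ hy₀ => ?_⟩
  have hαα₁ : α ≤ α₁ := hα₀.trans (min_le_left _ _)
  have hαL : L * α ≤ r - ‖xU t₁‖ := by
    rw [mul_comm, ← le_div_iff₀ hL]
    exact hα₀.trans (min_le_right _ _)
  obtain ⟨w, hw0, hw⟩ := exists_solution_of_bounded_locallyLipschitz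
    (truncatedField_locallyLipschitz hf hg hφ α hP) (C := max Cf Cg)
    (fun p => max_le_max (hfb _ _ _ (hPM _) (clamp_mem _) (hφ.mem_Icc' _))
      (hgb _ _ _ (hPM _) (clamp_mem _) (hφ.mem_Icc' _))) hT.le (xU 0, y₀)
  have hwx : ∀ t ∈ Icc 0 T, HasDerivWithinAt (fun t => (w t).1)
      (truncatedField f g φ α P ((w t).1, (w t).2)).1 (Icc 0 T) t := fun t ht => (hw t ht).fst
  have hwy : ∀ t ∈ Icc 0 T, HasDerivWithinAt (fun t => (w t).2)
      (truncatedField f g φ α P ((w t).1, (w t).2)).2 (Icc 0 T) t := fun t ht => (hw t ht).snd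
  have hwe := hest α hα hαα₁ _ _ hwx hwy (by rw [hw0]) (by rw [hw0]; exact hy₀)
  have hsol : IsSmoothedSolution f g φ α T (fun t => (w t).1) fun t => (w t).2 := by
    intro t ht
    obtain ⟨hy, hx⟩ := hwe t ht
    have hPx : P (w t).1 = (w t).1 := by
      refine hPr _ ?_
      linarith [norm_le_norm_add_norm_sub' (w t).1 (xU t), hr₀ t ht]
    have hcl : max (-1) (min 1 (w t).2) = (w t).2 :=
      clamp_eq ⟨by linarith [hy.1], by linarith [hy.2]⟩
    have h1 := hwx t ht
    have h2 := hwy t ht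
    simp only [truncatedField, hPx, hcl] at h1 h2
    exact ⟨h1, h2⟩
  refine ⟨⟨_, _, hsol, by simp [hw0], by simp [hw0]⟩, fun x y h hx0 hy0 t ht => ?_⟩
  have := h.eqOn hf hg hφ hsol (by simp [hw0, hx0]) (by simp [hw0, hy0]) ht
  rw [this]
  exact (hwe t ht).2
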